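/- A circuit over the gate set $\{\text{Toffoli}, \mathsf{CNOT}, \mathsf{X}\}$ is a sequence of layers of such gates, the gates of one layer acting on pairwise disjoint sets of qubits; its depth is its number of layers and its gate count is its total number of gates. There is a family of circuits $(C_n)_{n\in\mathbb{N}}$ over this gate set, where $C_n$ acts on a register of $n$ qubits and on one additional qubit (a dirty ancilla), such that for every $n$ the circuit $C_n$ implements the $n$-bit incrementer: the operator of $C_n$ is $\mathrm{Inc}_n \otimes I$, where $\mathrm{Inc}_n\,|v\rangle = |v+1 \bmod 2^n\rangle$ for every integer $0 \le v < 2^n$ (written in binary on the $n$ qubits) and $I$ is the identity on the ancilla. In particular, the ancilla may be in an arbitrary unknown state at the start and is returned to that state. As $n\to\infty$, the depth of $C_n$ is $O(\log^2 n)$ and the gate count of $C_n$ is $O(n \log n)$. -/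

import Mathlib

namespace QCircuit

/-- The operator on the state space with computational basis `(ι → Bool)` (one bit per qubit
`i : ι`) that sends each basis state `|x⟩` to the basis state `|f x⟩`. Columns are inputs. -/
def basisOp {ι : Type*} [Fintype ι] [DecidableEq ι] (f : (ι → Bool) → (ι → Bool)) :
    Matrix (ι → Bool) (ι → Bool) ℂ :=
  Matrix.of fun y x => if y = f x then 1 else 0

/-- A gate of the set {Toffoli, CNOT, X}, placed on pairwise distinct qubits of `ι`.
The target is the last qubit argument. -/
inductive Gate (ι : Type*) where
  | X (t : ι) : Gate ι
  | CNOT (c t : ι) (h : c ≠ t) : Gate ι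
  | Toffoli (c₁ c₂ t : ι) (h₁₂ : c₁ ≠ c₂) (h₁ : c₁ ≠ t) (h₂ : c₂ ≠ t) : Gate ι

namespace Gate

variable {ι : Type*} [DecidableEq ι]

/-- The set of qubits on which a gate is placed. -/
def support : Gate ι → Finset ι
  | X t => {t}
  | CNOT c t _ => {c, t}
  | Toffoli c₁ c₂ t _ _ _ => {c₁, c₂, t}

/-- The action of a gate on the labels of the computational basis states: the target bit is
XORed with the product of the control bits. -/
def act : Gate ι → (ι → Bool) → (ι → Bool)
  | X t, x => Function.update x t (!(x t))
  | CNOT c t _, x => Function.update x t (xor (x t) (x c))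
  | Toffoli c₁ c₂ t _ _ _, x => Function.update x t (xor (x t) (x c₁ && x c₂))

/-- The operator of a gate on the whole state space. -/
def op [Fintype ι] (g : Gate ι) : Matrix (ι → Bool) (ι → Bool) ℂ :=
  basisOp g.act

end Gate

/-- A circuit over {Toffoli, CNOT, X} on the qubits `ι`, as a sequence of layers (time steps);
the gates within one layer are placed on pairwise disjoint sets of qubits. -/
structure Circuit (ι : Type*) [DecidableEq ι] where
  layers : List (List (Gate ι))
  disjoint : ∀ L ∈ layers, L.Pairwise fun g h => Disjoint g.support h.support

namespace Circuit

variable {ι : Type*} [DecidableEq ι]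

/-- The number of layers. -/
def depth (C : Circuit ι) : ℕ := C.layers.length

/-- The total number of gates. -/
def gateCount (C : Circuit ι) : ℕ := (C.layers.map List.length).sum

/-- The operator implemented by a circuit: the product of the operators of its gates, the first
gate of the first layer being applied first (hence the rightmost factor). -/
def op [Fintype ι] (C : Circuit ι) : Matrix (ι → Bool) (ι → Bool) ℂ :=
  C.layers.flatten.foldl (fun M g => g.op * M) 1

/-- The circuit `C` implements the operator `U` on the register `α`, using the qubits of `β` as
dirty ancillae: the operator of `C` is `U ⊗ I`. So the ancillae may start in any state, possibly
entangled with the register, and are returned to it. -/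
def ImplementsWithDirty {α β : Type*} [Fintype α] [DecidableEq α] [Fintype β] [DecidableEq β]
    (C : Circuit (α ⊕ β)) (U : Matrix (α → Bool) (α → Bool) ℂ) : Prop :=
  C.op = (Matrix.kronecker U (1 : Matrix (β → Bool) (β → Bool) ℂ)).submatrix
    (Equiv.sumArrowEquivProdArrow α β Bool) (Equiv.sumArrowEquivProdArrow α β Bool)

end Circuit

/-- The incrementer `|v⟩ ↦ |v + 1 mod 2 ^ n⟩` on `n` qubits, where `|v⟩` is the basis state `x`
with `v = Nat.ofBits x = ∑ i, x i * 2 ^ i`. -/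
def incrementer (n : ℕ) : Matrix (Fin n → Bool) (Fin n → Bool) ℂ :=
  Matrix.of fun y x => if Nat.ofBits y = (Nat.ofBits x + 1) % 2 ^ n then 1 else 0

end QCircuit

/-
  Incrementing `A ++ H` amounts to incrementing `H` if `A` is all ones, and then `A`. Let `A`
  consist of about `2 log n` wires, so that a slow incrementer, which borrows any wire as a dirty
  ancilla to toggle each bit of `A` by the conjunction of the lower ones, is good enough there. On
  the states where `A` is all ones, complementing it yields zeros, which serve as clean workspace.

  With clean workspace, all carries of a block can be computed by a prefix circuit of logarithmic
  depth, but this takes twice as much workspace as the block is long. Therefore `H` is cut into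
  blocks of geometrically increasing lengths: the lowest block only needs the initial workspace, and
  whenever it overflows, its increment is zero and provides additional workspace for the next block.
  This gives `O(log n)` blocks of depth `O(log n)` each.

  The carry out of a block is a bit that controls the next block. For the first block, the control
  `b` is the ancilla, whose value is unknown. Let `F` increment `H` if `b` is set, at least when `A`
  is all ones, let `T` toggle `b` if `A` is all ones, and let `e` complement `H` if `b` is set. Then
  `e T (F T F⁻¹) e` increments `H` if `A` is all ones: for `b = 0` the increment comes from `F`, and
  for `b = 1` from `F⁻¹`, as complementation conjugates the decrement to the increment. If `A` is
  not all ones, then `T` does nothing and everything cancels.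
-/

namespace QCircuit

open Function

variable {ι : Type*}

/-- An assignment of bits to the wires, that is, the label of a computational basis state. -/
abbrev State (ι : Type*) := ι → Bool

/-- `f` only changes the bits of the wires in `S`, in a way that only depends on these bits. -/
structure LocalOn (S : Set ι) (f : State ι → State ι) : Prop where
  apply_of_notMem : ∀ x, ∀ v ∉ S, f x v = x v
  congr : ∀ x y, (∀ v ∈ S, x v = y v) → ∀ v ∈ S, f x v = f y v

namespace LocalOn

variable {S T : Set ι} {f g : State ι → State ι}

theorem mono (hf : LocalOn S f) (hST : S ⊆ T) : LocalOn T f where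
  apply_of_notMem x v hv := hf.apply_of_notMem x v fun hS => hv (hST hS)
  congr x y hxy v hv := by
    by_cases hS : v ∈ S
    · exact hf.congr x y (fun u hu => hxy u (hST hu)) v hS
    · rw [hf.apply_of_notMem x v hS, hf.apply_of_notMem y v hS, hxy v hv]

theorem id : LocalOn S (id : State ι → State ι) :=
  ⟨fun _ _ _ => rfl, fun _ _ h => h⟩

theorem comp (hf : LocalOn S f) (hg : LocalOn S g) : LocalOn S (f ∘ g) where
  apply_of_notMem x v hv := (hf.apply_of_notMem _ v hv).trans (hg.apply_of_notMem x v hv)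
  congr x y hxy := hf.congr _ _ (hg.congr x y hxy)

theorem comm (hf : LocalOn S f) (hg : LocalOn T g) (hST : Disjoint S T) (x : State ι) :
    f (g x) = g (f x) := by
  have hd {v : ι} (hS : v ∈ S) : v ∉ T := Set.disjoint_left.1 hST hS
  funext v
  by_cases hS : v ∈ S
  · rw [hg.apply_of_notMem _ v (hd hS),
      hf.congr (g x) x (fun u hu => hg.apply_of_notMem x u (hd hu)) v hS]
  · rw [hf.apply_of_notMem _ v hS]
    by_cases hT : v ∈ T
    · exact (hg.congr (f x) x (fun u hu => hf.apply_of_notMem x u fun h => hd h hu) v hT).symm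
    · rw [hg.apply_of_notMem _ v hT, hg.apply_of_notMem _ v hT, hf.apply_of_notMem _ v hS]

end LocalOn

theorem all_congr_of_eqOn {l : List ι} {x y : State ι} (h : ∀ v ∈ l, x v = y v) :
    l.all x = l.all y := by
  rw [Bool.eq_iff_iff, List.all_eq_true, List.all_eq_true]
  exact forall₂_congr fun v hv => by rw [h v hv]

variable [DecidableEq ι]

theorem localOn_update (t : ι) (b : Bool) : LocalOn {t} fun x : State ι => update x t b where
  apply_of_notMem x v hv := update_of_ne hv b x
  congr x y _ v hv := by rw [Set.mem_singleton_iff.1 hv, update_self, update_self]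

theorem LocalOn.apply_update {S : Set ι} {f : State ι → State ι} (hf : LocalOn S f) {t : ι}
    (ht : t ∉ S) (x : State ι) (b : Bool) : f (update x t b) = update (f x) t b :=
  hf.comm (localOn_update t b) (Set.disjoint_singleton_right.2 ht) x

/-- The map that flips the bit of the wire `t` in the states that satisfy the control `p`. -/
def toggle (t : ι) (p : State ι → Bool) (x : State ι) : State ι :=
  update x t (x t ^^ p x)

section Toggle

variable {t : ι} {p : State ι → Bool}

@[simp]
theorem toggle_apply_self (x : State ι) : toggle t p x t = (x t ^^ p x) :=
  update_self ..

theorem toggle_apply_of_ne {v : ι} (hv : v ≠ t) (x : State ι) : toggle t p x v = x v :=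
  update_of_ne hv ..

theorem toggle_of_eq_false {x : State ι} (h : p x = false) : toggle t p x = x := by
  simp [toggle, h]

theorem toggle_congr {q : State ι → Bool} {x : State ι} (h : p x = q x) :
    toggle t p x = toggle t q x := by
  rw [toggle, toggle, h]

theorem toggle_involutive (hp : ∀ x b, p (update x t b) = p x) : Involutive (toggle t p) :=
  fun x => by simp [toggle, hp]

theorem localOn_toggle {S : Set ι} (ht : t ∈ S)
    (hp : ∀ x y, (∀ v ∈ S, x v = y v) → p x = p y) : LocalOn S (toggle t p) where
  apply_of_notMem x v hv := toggle_apply_of_ne (fun h => hv (by rwa [h])) x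
  congr x y hxy v hv := by
    by_cases hvt : v = t
    · rw [hvt, toggle_apply_self, toggle_apply_self, hxy t ht, hp x y hxy]
    · rw [toggle_apply_of_ne hvt, toggle_apply_of_ne hvt, hxy v hv]

theorem LocalOn.commutator_toggle {S : Set ι} {f : State ι → State ι} (hf : LocalOn S f)
    (hff : Involutive f) (ht : t ∉ S) (hp : ∀ x b, p (update x t b) = p x) :
    f ∘ toggle t p ∘ f ∘ toggle t p = toggle t fun x => p x ^^ p (f x) := by
  funext x
  simp only [comp_apply, toggle, hf.apply_update ht, hp, update_self, update_idem, hff x,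
    Bool.xor_assoc]

end Toggle

namespace Gate

theorem act_X (t : ι) : (X t).act = toggle t fun _ => true := by
  funext x
  simp [act, toggle]

theorem act_CNOT {c t : ι} (h : c ≠ t) : (CNOT c t h).act = toggle t fun x => x c :=
  rfl

theorem act_Toffoli {c₁ c₂ t : ι} (h₁₂ : c₁ ≠ c₂) (h₁ : c₁ ≠ t) (h₂ : c₂ ≠ t) :
    (Toffoli c₁ c₂ t h₁₂ h₁ h₂).act = toggle t fun x => x c₁ && x c₂ :=
  rfl

theorem act_involutive (g : Gate ι) : Involutive g.act := by
  cases g with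
  | X t => exact act_X t ▸ toggle_involutive fun _ _ => rfl
  | CNOT c t h => exact toggle_involutive fun x b => update_of_ne h b x
  | Toffoli c₁ c₂ t _ h₁ h₂ =>
    exact toggle_involutive fun x b => by rw [update_of_ne h₁, update_of_ne h₂]

theorem localOn_act (g : Gate ι) : LocalOn (g.support : Set ι) g.act := by
  cases g with
  | X t => exact act_X t ▸ localOn_toggle (by simp [support]) fun _ _ _ => rfl
  | CNOT c t h => exact localOn_toggle (by simp [support]) fun x y hxy => hxy c (by simp [support])
  | Toffoli c₁ c₂ t _ _ _ =>
    refine localOn_toggle (by simp [support]) fun x y hxy => ?_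
    rw [hxy c₁ (by simp [support]), hxy c₂ (by simp [support])]

end Gate

/-- The action of a sequence of gates, the head being applied first. -/
def run (L : List (Gate ι)) (x : State ι) : State ι :=
  L.foldl (fun y g => g.act y) x

@[simp]
theorem run_nil (x : State ι) : run [] x = x := rfl

@[simp]
theorem run_cons (g : Gate ι) (L : List (Gate ι)) (x : State ι) :
    run (g :: L) x = run L (g.act x) := rfl

@[simp]
theorem run_append (L M : List (Gate ι)) (x : State ι) : run (L ++ M) x = run M (run L x) :=
  List.foldl_append

theorem run_run_reverse (L : List (Gate ι)) (x : State ι) : run L (run L.reverse x) = x := by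
  induction L generalizing x with
  | nil => rfl
  | cons g L ih => simp [g.act_involutive _, ih]

theorem localOn_run {S : Set ι} {L : List (Gate ι)} (h : ∀ g ∈ L, (g.support : Set ι) ⊆ S) :
    LocalOn S (run L) := by
  induction L with
  | nil => exact LocalOn.id
  | cons g L ih =>
    rw [List.forall_mem_cons] at h
    exact (ih h.2).comp (g.localOn_act.mono h.1)

theorem run_apply_of_mem_support {L : List (Gate ι)}
    (hL : L.Pairwise fun g g' => Disjoint g.support g'.support) {g : Gate ι} (hg : g ∈ L)
    {v : ι} (hv : v ∈ g.support) (x : State ι) : run L x v = g.act x v := by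
  induction L generalizing x with
  | nil => simp at hg
  | cons g' L ih =>
    obtain ⟨hg', hL⟩ := List.pairwise_cons.1 hL
    rw [run_cons]
    rcases List.mem_cons.1 hg with rfl | hg
    · have hrest : LocalOn {u | u ∉ g.support} (run L) := localOn_run fun k hk u hu hug =>
        Finset.disjoint_left.1 (hg' k hk) hug hu
      exact hrest.apply_of_notMem _ v (not_not_intro hv)
    · rw [ih hL hg]
      refine g.localOn_act.congr _ _ (fun u hu => g'.localOn_act.apply_of_notMem x u ?_) v hv
      exact Finset.disjoint_right.1 (hg' g hg) hu

/-- Some circuit on the wires in `l`, of depth at most `d` and with at most `k` gates, acts on the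
basis states as the map `f`. -/
def Realizes (l : List ι) (f : State ι → State ι) (d k : ℕ) : Prop :=
  ∃ C : Circuit ι, (∀ g ∈ C.layers.flatten, ∀ v ∈ g.support, v ∈ l) ∧
    run C.layers.flatten = f ∧ C.depth ≤ d ∧ C.gateCount ≤ k

namespace Realizes

variable {l m : List ι} {f g : State ι → State ι} {d d' k k' : ℕ}

theorem localOn (hf : Realizes l f d k) : LocalOn {v | v ∈ l} f := by
  obtain ⟨C, hl, rfl, -⟩ := hf
  exact localOn_run fun g hg v hv => hl g hg v hv

theorem apply_of_notMem (hf : Realizes l f d k) {v : ι} (hv : v ∉ l) (x : State ι) :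
    f x v = x v :=
  hf.localOn.apply_of_notMem x v hv

theorem mono (hf : Realizes l f d k) (hl : l ⊆ m) (hd : d ≤ d') (hk : k ≤ k') :
    Realizes m f d' k' := by
  obtain ⟨C, hC, hCf, hCd, hCk⟩ := hf
  exact ⟨C, fun g hg v hv => hl (hC g hg v hv), hCf, hCd.trans hd, hCk.trans hk⟩

theorem congr (hf : Realizes l f d k) (h : ∀ x, g x = f x) : Realizes l g d k := by
  rwa [funext h]

theorem id : Realizes l (id : State ι → State ι) 0 0 :=
  ⟨⟨[], by simp⟩, by simp, rfl, le_rfl, le_rfl⟩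

theorem comp (hg : Realizes m g d' k') (hf : Realizes l f d k) :
    Realizes (m ++ l) (g ∘ f) (d' + d) (k' + k) := by
  obtain ⟨C, hl, rfl, hd, hk⟩ := hf
  obtain ⟨C', hm, rfl, hd', hk'⟩ := hg
  refine ⟨⟨C.layers ++ C'.layers, fun L hL => ?_⟩, ?_, ?_, ?_, ?_⟩
  · exact (List.mem_append.1 hL).elim (C.disjoint L) (C'.disjoint L)
  · simp only [List.flatten_append, List.mem_append]
    exact fun g hg v hv => hg.symm.imp (hm g · v hv) (hl g · v hv)
  · funext x
    simp
  · simp only [Circuit.depth, List.length_append] at *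
    lia
  · simp only [Circuit.gateCount, List.map_append, List.sum_append] at *
    lia

theorem exists_inverse (hf : Realizes l f d k) :
    ∃ g, Realizes l g d k ∧ LeftInverse g f ∧ RightInverse g f := by
  obtain ⟨C, hl, rfl, hd, hk⟩ := hf
  refine ⟨run C.layers.flatten.reverse, ⟨⟨(C.layers.map List.reverse).reverse, ?_⟩, ?_, ?_, ?_, ?_⟩,
    fun x => ?_, run_run_reverse _⟩
  · simp only [List.mem_reverse, List.forall_mem_map, List.pairwise_reverse]
    exact fun L hL => (C.disjoint L hL).imp fun h => h.symm
  · simpa only [← List.reverse_flatten, List.mem_reverse] using hl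
  · rw [List.reverse_flatten]
  · simpa [Circuit.depth] using hd
  · simpa [Circuit.gateCount, comp_def] using hk
  · simpa using run_run_reverse C.layers.flatten.reverse x

theorem injective (hf : Realizes l f d k) : Injective f :=
  let ⟨_, _, hgf, _⟩ := hf.exists_inverse
  hgf.injective

theorem surjective (hf : Realizes l f d k) : Surjective f :=
  let ⟨_, _, _, hgf⟩ := hf.exists_inverse
  hgf.surjective

theorem exists_semiconj (hg : Realizes l g d k) (hf : Realizes m f d' k') :
    ∃ c, Realizes (l ++ m) c (2 * d + d') (2 * k + k') ∧ Semiconj g c f := by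
  obtain ⟨g', hg', -, hgg'⟩ := hg.exists_inverse
  refine ⟨g' ∘ f ∘ g, (hg'.comp (hf.comp hg)).mono ?_ (by lia) (by lia), fun x => hgg' _⟩
  simp

theorem exists_semiconj' (hg : Realizes l g d k) (hf : Realizes m f d' k') :
    ∃ c, Realizes (l ++ m) c (2 * d + d') (2 * k + k') ∧ Semiconj g f c := by
  obtain ⟨g', hg', hg'g, hgg'⟩ := hg.exists_inverse
  obtain ⟨c, hc, hg'c⟩ := hg'.exists_semiconj hf
  exact ⟨c, hc, hg'c.inverse_left hgg' hg'g⟩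

end Realizes

theorem realizes_act (g : Gate ι) {l : List ι} (hl : ∀ v ∈ g.support, v ∈ l) :
    Realizes l g.act 1 1 :=
  ⟨⟨[[g]], by simp⟩, by simpa using hl, rfl, le_rfl, by simp [Circuit.gateCount]⟩

theorem realizes_not (t : ι) : Realizes [t] (toggle t fun _ => true) 1 1 :=
  Gate.act_X t ▸ realizes_act _ (by simp [Gate.support])

theorem realizes_cnot {c t : ι} (h : c ≠ t) : Realizes [c, t] (toggle t fun x => x c) 1 1 :=
  realizes_act (.CNOT c t h) (by simp [Gate.support])

theorem realizes_toffoli {c₁ c₂ t : ι} (h : [c₁, c₂, t].Nodup) :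
    Realizes [c₁, c₂, t] (toggle t fun x => x c₁ && x c₂) 1 1 := by
  simp only [List.nodup_cons, List.mem_cons, List.not_mem_nil, or_false, not_or] at h
  exact realizes_act (.Toffoli c₁ c₂ t h.1.1 h.1.2 h.2.1) (by simp [Gate.support])

section Layers

variable {α : Type*}

theorem exists_toggleLayer (l : List α) (t : α → ι) (p : α → State ι → Bool) (S : α → List ι)
    (hS : (l.flatMap S).Nodup) (ht : ∀ a ∈ l, t a ∈ S a)
    (hg : ∀ a ∈ l, ∃ g : Gate ι, g.support = (S a).toFinset ∧ g.act = toggle (t a) (p a)) :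
    ∃ F, Realizes (l.flatMap S) F 1 l.length ∧ (∀ x, ∀ v ∉ l.map t, F x v = x v) ∧
      ∀ a ∈ l, ∀ x, F x (t a) = (x (t a) ^^ p a x) := by
  choose g hg hgp using hg
  let L : List (Gate ι) := l.pmap g fun _ ha => ha
  have hsupport {a : α} (ha : a ∈ l) {v : ι} : v ∈ (g a ha).support ↔ v ∈ S a := by
    rw [hg, List.mem_toFinset]
  have hmem {a : α} (ha : a ∈ l) : g a ha ∈ L := List.mem_pmap.2 ⟨a, ha, rfl⟩
  have hL : L.Pairwise fun g g' => Disjoint g.support g'.support := by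
    refine (List.pairwise_pmap _).2 ((List.nodup_flatMap.1 hS).2.imp fun hab ha hb => ?_)
    simp only [Finset.disjoint_left, hsupport]
    exact fun v hv hv' => hab hv hv'
  have hlocal : LocalOn {v | ∃ a ∈ l, v ∈ S a} (run L) := by
    refine localOn_run fun g' hg' v hv => ?_
    obtain ⟨a, ha, rfl⟩ := List.mem_pmap.1 hg'
    exact ⟨a, ha, (hsupport ha).1 hv⟩
  have hrun {a : α} (ha : a ∈ l) {v : ι} (hv : v ∈ S a) (x : State ι) :
      run L x v = toggle (t a) (p a) x v := by
    rw [run_apply_of_mem_support hL (hmem ha) ((hsupport ha).2 hv), hgp]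
  refine ⟨run L, ⟨⟨[L], by simpa using hL⟩, ?_, by simp, le_rfl, by simp [Circuit.gateCount, L]⟩,
    fun x v hv => ?_, fun a ha x => by rw [hrun ha (ht a ha), toggle_apply_self]⟩
  · intro g' hg' v hv
    obtain ⟨a, ha, rfl⟩ := List.mem_pmap.1 (show g' ∈ L by simpa using hg')
    exact List.mem_flatMap.2 ⟨a, ha, (hsupport ha).1 hv⟩
  · by_cases h : ∃ a ∈ l, v ∈ S a
    · obtain ⟨a, ha, hva⟩ := h
      rw [hrun ha hva, toggle_apply_of_ne fun h => hv (List.mem_map.2 ⟨a, ha, h.symm⟩)]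
    · exact hlocal.apply_of_notMem x v h

theorem exists_cnotLayer (l : List α) (c t : α → ι) (h : (l.flatMap fun a => [c a, t a]).Nodup) :
    ∃ F, Realizes (l.flatMap fun a => [c a, t a]) F 1 l.length ∧
      (∀ x, ∀ v ∉ l.map t, F x v = x v) ∧ ∀ a ∈ l, ∀ x, F x (t a) = (x (t a) ^^ x (c a)) := by
  refine exists_toggleLayer l t (fun a x => x (c a)) _ h (by simp) fun a ha => ?_
  have hne : c a ≠ t a := by simpa using (List.nodup_flatMap.1 h).1 a ha
  exact ⟨.CNOT (c a) (t a) hne, by simp [Gate.support], Gate.act_CNOT hne⟩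

theorem exists_toffoliLayer (l : List α) (c₁ c₂ t : α → ι)
    (h : (l.flatMap fun a => [c₁ a, c₂ a, t a]).Nodup) :
    ∃ F, Realizes (l.flatMap fun a => [c₁ a, c₂ a, t a]) F 1 l.length ∧
      (∀ x, ∀ v ∉ l.map t, F x v = x v) ∧
      ∀ a ∈ l, ∀ x, F x (t a) = (x (t a) ^^ (x (c₁ a) && x (c₂ a))) := by
  refine exists_toggleLayer l t (fun a x => x (c₁ a) && x (c₂ a)) _ h (by simp) fun a ha => ?_
  have hne : (c₁ a ≠ c₂ a ∧ c₁ a ≠ t a) ∧ c₂ a ≠ t a := by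
    simpa using (List.nodup_flatMap.1 h).1 a ha
  exact ⟨.Toffoli (c₁ a) (c₂ a) (t a) hne.1.1 hne.1.2 hne.2, by simp [Gate.support],
    Gate.act_Toffoli ..⟩

end Layers

/-- The map that flips the bits of the wires in `l` if `b` is true. -/
def flipOn (l : List ι) (b : Bool) (x : State ι) : State ι :=
  fun v => if v ∈ l then x v ^^ b else x v

section FlipOn

variable {l : List ι} {v : ι}

theorem flipOn_of_mem (hv : v ∈ l) (b : Bool) (x : State ι) : flipOn l b x v = (x v ^^ b) :=
  if_pos hv

theorem flipOn_of_notMem (hv : v ∉ l) (b : Bool) (x : State ι) : flipOn l b x v = x v :=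
  if_neg hv

@[simp]
theorem flipOn_false (l : List ι) (x : State ι) : flipOn l false x = x := by
  funext v
  simp [flipOn]

@[simp]
theorem flipOn_flipOn (l : List ι) (b : Bool) (x : State ι) : flipOn l b (flipOn l b x) = x := by
  funext v
  by_cases hv : v ∈ l <;> simp [flipOn, hv]

theorem localOn_flipOn (l : List ι) (b : Bool) : LocalOn {v | v ∈ l} (flipOn l b) where
  apply_of_notMem x _ hv := flipOn_of_notMem hv b x
  congr x y hxy v hv := by rw [flipOn_of_mem hv, flipOn_of_mem hv, hxy v hv]

theorem flipOn_append {s m : List ι} (h : s.Disjoint m) {g : State ι → State ι}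
    (hgo : ∀ x, ∀ v ∉ m, g x v = x v) (hgt : ∀ v ∈ m, ∃ u ∈ s, ∀ x, g x v = (x v ^^ x u))
    (b : Bool) (x : State ι) : g (flipOn s b (g x)) = flipOn (s ++ m) b x := by
  funext v
  by_cases hm : v ∈ m
  · obtain ⟨u, hu, hgu⟩ := hgt v hm
    rw [flipOn_of_mem (List.mem_append_right s hm), hgu, flipOn_of_mem hu,
      flipOn_of_notMem fun hs => h hs hm, hgu, hgo x u (h hu)]
    simp
  · by_cases hs : v ∈ s
    · rw [hgo _ v hm, flipOn_of_mem hs, hgo x v hm, flipOn_of_mem (List.mem_append_left m hs)]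
    · rw [hgo _ v hm, flipOn_of_notMem hs, hgo x v hm, flipOn_of_notMem (by simp [hs, hm])]

theorem flipOn_perm {l m : List ι} (h : l.Perm m) (b : Bool) (x : State ι) :
    flipOn l b x = flipOn m b x := by
  funext v
  simp only [flipOn, h.mem_iff]

end FlipOn

theorem realizes_flipOn {l : List ι} (hl : l.Nodup) : Realizes l (flipOn l true) 1 l.length := by
  obtain ⟨F, hF, hFo, hFt⟩ := exists_toggleLayer l id (fun _ _ => true) (fun a => [a])
    (by simpa using hl) (by simp) fun a _ => ⟨.X a, by simp [Gate.support], Gate.act_X a⟩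
  convert ← hF.mono (m := l) (by simp) le_rfl le_rfl using 1
  funext x v
  by_cases hv : v ∈ l
  · exact (hFt v hv x).trans (flipOn_of_mem hv true x).symm
  · rw [hFo x v (by simpa using hv), flipOn_of_notMem hv]

theorem exists_flatMap_pair_append {α : Type*} : ∀ l : List α,
    ∃ (B : List (α × α)) (r : List α), l = B.flatMap (fun b => [b.1, b.2]) ++ r ∧ r.length ≤ 1
  | [] => ⟨[], [], rfl, by simp⟩
  | [a] => ⟨[], [a], rfl, le_rfl⟩
  | a :: b :: l =>
    let ⟨B, r, hl, hr⟩ := exists_flatMap_pair_append l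
    ⟨(a, b) :: B, r, by simp [hl], hr⟩

theorem flatMap_pair_perm {α β : Type*} (l : List α) (f g : α → β) :
    (l.flatMap fun a => [f a, g a]).Perm (l.map f ++ l.map g) := by
  simpa [List.map_eq_flatMap] using (l.flatMap_append_perm (fun a => [f a]) fun a => [g a]).symm

theorem flatMap_triple_perm {α β : Type*} (l : List α) (f g h : α → β) :
    (l.flatMap fun a => [f a, g a, h a]).Perm (l.map f ++ (l.map g ++ l.map h)) :=
  (l.flatMap_append_perm (fun a => [f a]) fun a => [g a, h a]).symm.trans <| by
    rw [← List.map_eq_flatMap]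
    exact (flatMap_pair_perm l g h).append_left _

theorem realizes_fanout (K : ℕ) {q : ι} {l : List ι} (hl : l.length ≤ 2 ^ K) (h : (q :: l).Nodup) :
    Realizes (q :: l) (fun x => flipOn l (x q) x) (2 * K + 1) (2 * l.length) := by
  induction K generalizing l with
  | zero =>
    match l, hl with
    | [], _ =>
      exact (Realizes.id.mono (List.nil_subset _) (Nat.zero_le _) (Nat.zero_le _)).congr
        fun x => by funext v; simp [flipOn]
    | [a], _ =>
      have hqa : q ≠ a := by simpa using h
      refine ((realizes_cnot hqa).mono (List.Subset.refl _) (by lia) (by simp)).congr fun x => ?_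
      funext v
      by_cases hv : v = a <;> simp [flipOn, toggle, hv]
  | succ K ih =>
    obtain ⟨B, r, hB, hr⟩ := exists_flatMap_pair_append l
    have hperm : l.Perm ((r ++ B.map Prod.fst) ++ B.map Prod.snd) := by
      rw [hB, List.append_assoc]
      exact ((flatMap_pair_perm B _ _).append_right r).trans List.perm_append_comm
    have hlen : l.length = r.length + (B.length + B.length) := by simpa using hperm.length_eq
    have hnodup := (hperm.cons q).nodup_iff.1 h
    rw [← List.cons_append, List.nodup_append'] at hnodup
    obtain ⟨g, hg, hgo, hgt⟩ := exists_cnotLayer B Prod.fst Prod.snd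
      (List.nodup_append'.1 (hB ▸ (List.nodup_cons.1 h).2)).1
    have hf := @ih (r ++ B.map Prod.fst) (by grind) hnodup.1
    refine ((hg.comp (hf.comp hg)).mono ?_ (by lia) (by grind)).congr fun x => ?_
    · simp only [hB]
      grind
    · simp only [comp_apply, hgo x q (hnodup.2.2 List.mem_cons_self)]
      rw [flipOn_append _ hgo]
      · exact flipOn_perm hperm _ x
      · simp only [List.forall_mem_map]
        exact fun p hp => ⟨p.1, List.mem_append_right r (List.mem_map_of_mem hp), hgt p hp⟩
      · exact fun v hv => hnodup.2.2 (List.mem_cons_of_mem q hv)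

theorem all_update_of_notMem {l : List ι} {t : ι} (ht : t ∉ l) (x : State ι) (b : Bool) :
    l.all (update x t b) = l.all x :=
  all_congr_of_eqOn fun v hv => update_of_ne (fun hvt => ht (by rwa [← hvt])) b x

theorem localOn_toggle_all (t : ι) (cs : List ι) : LocalOn {v | v ∈ t :: cs} (toggle t cs.all) :=
  localOn_toggle (by simp) fun _ _ hxy =>
    all_congr_of_eqOn fun v hv => hxy v (List.mem_cons_of_mem t hv)

theorem realizes_toggle_all_of_length_le_one {t : ι} {cs : List ι} (hcs : cs.length ≤ 1)
    (h : (t :: cs).Nodup) : Realizes (t :: cs) (toggle t cs.all) 1 1 := by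
  match cs, hcs with
  | [], _ => exact realizes_not t
  | [c], _ =>
    have hct : c ≠ t := by simpa [eq_comm] using h
    exact ((realizes_cnot hct).mono (by simp) le_rfl le_rfl).congr fun x => by simp [toggle]

theorem exists_involutive_toggle_all {t : ι} {cs gs : List ι} (hlen : cs.length ≤ gs.length + 1)
    (h : (t :: (cs ++ gs)).Nodup) : ∃ f : State ι → State ι,
      Realizes (t :: (cs ++ gs)) f (2 * cs.length + 1) (2 * cs.length + 1) ∧ Involutive f ∧
      (∀ x, ∀ v ∈ cs, f x v = x v) ∧ ∀ x, f x t = (x t ^^ cs.all x) := by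
  induction cs generalizing t gs with
  | nil => exact ⟨_, (realizes_not t).mono (by simp) (by simp) (by simp),
      toggle_involutive fun _ _ => rfl, by simp, by simp⟩
  | cons c cs ih =>
    have htc : t ∉ c :: cs := by grind
    cases gs with
    | nil =>
      have hcs : (c :: cs).length ≤ 1 := hlen
      exact ⟨_, (realizes_toggle_all_of_length_le_one hcs (by simpa using h)).mono (by simp)
        (by lia) (by lia), toggle_involutive (all_update_of_notMem htc),
        fun x v hv => toggle_apply_of_ne (by grind) x, toggle_apply_self⟩
    | cons g gs =>
      obtain ⟨f, hf, hff, hfcs, hfg⟩ := @ih g gs (by simpa using hlen) (by grind)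
      have htoffoli := realizes_toffoli (c₁ := c) (c₂ := g) (t := t) (by grind)
      have hinv : Involutive (toggle t fun x => x c && x g) :=
        toggle_involutive fun x b => by rw [update_of_ne (by grind), update_of_ne (by grind)]
      have hcons (x : State ι) : ∀ v ∈ c :: cs, f x v = x v := by
        rintro v (_ | ⟨_, hv⟩)
        · exact hf.apply_of_notMem (by grind) x
        · exact hfcs x v hv
      have hne {v : ι} (hv : v ∈ c :: cs) : v ≠ t := fun hvt => htc (hvt ▸ hv)
      refine ⟨_, (htoffoli.comp (hf.comp htoffoli)).mono (by grind) (by grind) (by grind),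
        fun x => by simp [hinv _, hff _], fun x v hv => ?_, fun x => ?_⟩
      · rw [comp_apply, toggle_apply_of_ne (hne hv), comp_apply, hcons _ v hv,
          toggle_apply_of_ne (hne hv)]
      · have hall : cs.all (toggle t (fun x => x c && x g) x) = cs.all x :=
          all_congr_of_eqOn fun v hv => toggle_apply_of_ne (hne (List.mem_cons_of_mem c hv)) x
        rw [comp_apply, toggle_apply_self, comp_apply, hcons _ c List.mem_cons_self, hfg, hall,
          hf.apply_of_notMem (by grind), toggle_apply_self, toggle_apply_of_ne (by grind),
          toggle_apply_of_ne (by grind), List.all_cons]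
        cases x t <;> cases x c <;> cases x g <;> simp

theorem realizes_toggle_all_of_length_le {t : ι} {cs gs : List ι} (hlen : cs.length ≤ gs.length + 1)
    (h : (t :: (cs ++ gs)).Nodup) :
    Realizes (t :: (cs ++ gs)) (toggle t cs.all) (4 * cs.length + 2) (4 * cs.length + 2) := by
  match cs, gs, hlen with
  | [], gs, _ =>
    exact (realizes_not t).mono (by simp) (by simp) (by simp)
  | c :: cs, [], (hlen : (c :: cs).length ≤ 1) =>
    exact (realizes_toggle_all_of_length_le_one hlen (by simpa using h)).mono (by simp)
      (by lia) (by lia)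
  | c :: cs, g :: gs, hlen =>
    obtain ⟨f, hf, hff, -, hfg⟩ := exists_involutive_toggle_all (t := g) (cs := cs) (gs := gs)
      (by simpa using hlen) (by grind)
    have htoffoli := realizes_toffoli (c₁ := c) (c₂ := g) (t := t) (by grind)
    refine ((hf.comp (htoffoli.comp (hf.comp htoffoli))).mono (by grind) (by grind)
      (by grind)).congr fun x => ?_
    rw [hf.localOn.commutator_toggle hff (by grind)
      fun x b => by rw [update_of_ne (by grind), update_of_ne (by grind)]]
    refine toggle_congr ?_
    rw [hfg, hf.apply_of_notMem (by grind), List.all_cons]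
    cases x c <;> simp

theorem realizes_toggle_all {t d : ι} {cs : List ι} (h : (t :: d :: cs).Nodup) :
    Realizes (t :: d :: cs) (toggle t cs.all) (8 * cs.length + 16) (8 * cs.length + 16) := by
  obtain ⟨a, b, rfl, ha, hb⟩ : ∃ a b, cs = a ++ b ∧ a.length ≤ b.length + 1 ∧
      b.length ≤ a.length :=
    ⟨cs.take ((cs.length + 1) / 2), cs.drop ((cs.length + 1) / 2), by simp, by grind,
      by grind⟩
  have hf := realizes_toggle_all_of_length_le (t := d) ha (by grind)
  have hg := realizes_toggle_all_of_length_le (t := t) (cs := d :: b) (gs := a) (by simpa using hb)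
    (by grind)
  have hda : d ∉ a := by grind
  have htb : t ∉ d :: b := by grind
  have hdb : d ∉ b := by grind
  refine ((hf.comp (hg.comp (hf.comp hg))).mono (by grind) (by grind)
      (by grind)).congr fun x => ?_
  rw [(localOn_toggle_all d a).commutator_toggle (toggle_involutive (all_update_of_notMem hda))
    (by grind) (all_update_of_notMem htb)]
  have hall : b.all (toggle d a.all x) = b.all x := all_update_of_notMem hdb x _
  refine toggle_congr ?_
  rw [List.all_cons, List.all_cons, hall, toggle_apply_self, List.all_append]
  cases x d <;> cases a.all x <;> simp

/-- The increment modulo `2 ^ l.length` of the number stored in the register `l`, the head of `l`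
being the least significant bit. -/
def inc : List ι → State ι → State ι
  | [], x => x
  | a :: l, x => update (if x a then inc l x else x) a (!x a)

theorem localOn_inc (l : List ι) : LocalOn {v | v ∈ l} (inc l) := by
  induction l with
  | nil => exact LocalOn.id
  | cons a l ih =>
    have ih := ih.mono (T := {v | v ∈ a :: l}) fun v hv => List.mem_cons_of_mem a hv
    refine ⟨fun x v hv => ?_, fun x y hxy v hv => ?_⟩
    · rw [inc, update_of_ne (List.ne_of_not_mem_cons hv)]
      split
      · exact ih.apply_of_notMem x v hv
      · rfl
    · rw [inc, inc, hxy a List.mem_cons_self]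
      by_cases hva : v = a
      · rw [hva, update_self, update_self]
      · rw [update_of_ne hva, update_of_ne hva]
        split
        · exact ih.congr x y hxy v hv
        · exact hxy v hv

theorem inc_of_notMem {l : List ι} {v : ι} (hv : v ∉ l) (x : State ι) : inc l x v = x v :=
  (localOn_inc l).apply_of_notMem x v hv

theorem inc_append {l m : List ι} (h : l.Disjoint m) (x : State ι) :
    inc (l ++ m) x = inc l (if l.all x then inc m x else x) := by
  induction l with
  | nil => simp [inc]
  | cons a l ih =>
    rw [List.disjoint_cons_left] at h
    have ha : (if (a :: l).all x then inc m x else x) a = x a := by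
      split
      · exact inc_of_notMem h.1 x
      · rfl
    rw [List.cons_append, inc, inc, ha, ih h.2]
    cases hx : x a <;> simp [hx]

theorem inc_append_singleton {l : List ι} {a : ι} (ha : a ∉ l) (x : State ι) :
    inc (l ++ [a]) x = inc l (toggle a l.all x) := by
  rw [inc_append (by simpa using ha)]
  cases hx : l.all x <;> simp [inc, toggle, hx]

theorem inc_apply_eq_false {l : List ι} {x : State ι} (hx : l.all x = true) {v : ι} (hv : v ∈ l) :
    inc l x v = false := by
  induction l with
  | nil => simp at hv
  | cons a l ih =>
    rw [List.all_cons, Bool.and_eq_true] at hx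
    rw [inc, hx.1, if_pos rfl]
    rcases eq_or_ne v a with rfl | hva
    · simp
    · rw [update_of_ne hva, ih hx.2 (List.mem_of_ne_of_mem hva hv)]

theorem inc_flipOn_inc {l : List ι} (h : l.Nodup) (x : State ι) :
    inc l (flipOn l true (inc l x)) = flipOn l true x := by
  induction l generalizing x with
  | nil => funext v; simp [inc, flipOn]
  | cons a l ih =>
    obtain ⟨ha, hl⟩ := List.nodup_cons.1 h
    have hcons (y : State ι) : flipOn (a :: l) true y = update (flipOn l true y) a (!y a) := by
      funext v
      by_cases hv : v = a <;> simp [flipOn, hv]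
    cases hx : x a <;>
      simp [hcons, inc, hx, (localOn_flipOn l true).apply_update ha,
        (localOn_inc l).apply_update ha, ih hl]

theorem realizes_inc_quadratic {d : ι} {l : List ι} (h : (d :: l).Nodup) :
    Realizes (d :: l) (inc l) (l.length * (8 * l.length + 16))
      (l.length * (8 * l.length + 16)) := by
  induction l using List.reverseRecOn with
  | nil => exact Realizes.id.mono (List.nil_subset _) (by simp) (by simp)
  | append_singleton l a ih =>
    have hl := ih (by grind)
    have ha := realizes_toggle_all (t := a) (d := d) (cs := l) (by grind)
    refine ((hl.comp ha).mono (by grind) ?_ ?_).congr fun x => ?_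
    · simp only [List.length_append, List.length_singleton]
      nlinarith
    · simp only [List.length_append, List.length_singleton]
      nlinarith
    · rw [inc_append_singleton (by grind), comp_apply]

/-- In the state `z`, the wires `p.2` with `p ∈ l` hold the conjunctions of `a` with the bits of
the preceding wires `p.1`. For `a = true` these are the carries in the increment of the register
`l.map Prod.fst`. -/
def IsPrefix {ι : Type*} : List (ι × ι) → Bool → State ι → Prop
  | [], _, _ => True
  | p :: l, a, z => z p.2 = a ∧ IsPrefix l (a && z p.1) z

theorem isPrefix_congr {ι : Type*} {l : List (ι × ι)} {a : Bool} {y z : State ι}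
    (h : ∀ p ∈ l, z p.1 = y p.1 ∧ z p.2 = y p.2) : IsPrefix l a z ↔ IsPrefix l a y := by
  induction l generalizing a with
  | nil => rfl
  | cons p l ih =>
    rw [List.forall_mem_cons] at h
    rw [IsPrefix, IsPrefix, h.1.1, h.1.2, ih h.2]

theorem isPrefix_flatMap_pair_append {ι : Type*} {B : List ((ι × ι) × ι × ι)} {r : List (ι × ι)}
    {a : Bool} {y z : State ι} (hB : ∀ b ∈ B, y b.2.2 = (z b.1.1 && z b.2.1) ∧
      z b.1.2 = y b.1.2 ∧ z b.2.2 = (z b.1.2 && z b.1.1))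
    (hr : ∀ p ∈ r, z p.1 = y p.1 ∧ z p.2 = y p.2)
    (hy : IsPrefix (B.map (fun b => (b.2.2, b.1.2)) ++ r) a y) :
    IsPrefix (B.flatMap (fun b => [b.1, b.2]) ++ r) a z := by
  induction B generalizing a with
  | nil => exact (isPrefix_congr hr).2 hy
  | cons b B ih =>
    obtain ⟨⟨hb₁, hb₂, hb₃⟩, hB⟩ := List.forall_mem_cons.1 hB
    obtain ⟨rfl, hy⟩ := hy
    refine ⟨hb₂, by rw [hb₃, hb₂], ?_⟩
    rw [Bool.and_assoc, ← hb₁]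
    exact ih hB hy

theorem map_snd_flatMap_pair_append_perm {α β : Type*} (B : List ((α × β) × α × β))
    (r : List (α × β)) : ((B.flatMap (fun b => [b.1, b.2]) ++ r).map Prod.snd).Perm
      ((B.map (fun b => b.1.2) ++ r.map Prod.snd) ++ B.map fun b => b.2.2) := by
  simp only [List.map_append, List.map_flatMap, List.map_cons, List.map_nil]
  refine ((flatMap_pair_perm B _ _).append_right _).trans ?_
  rw [List.append_assoc, List.append_assoc]
  exact List.perm_append_comm.append_left _

theorem flatMap_subset_flatMap {α β : Type*} {l : List α} {f g : α → List β}
    (h : ∀ a ∈ l, g a ⊆ f a) : l.flatMap g ⊆ l.flatMap f := fun v hv => by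
  obtain ⟨a, ha, hva⟩ := List.mem_flatMap.1 hv
  exact List.mem_flatMap.2 ⟨a, ha, h a ha hva⟩

theorem nodup_flatMap_of_subset {α β : Type*} {l : List α} {f g : α → List β}
    (h : (l.flatMap f).Nodup) (hg : ∀ a ∈ l, (f a).Nodup → (g a).Nodup)
    (hgf : ∀ a ∈ l, g a ⊆ f a) : (l.flatMap g).Nodup := by
  rw [List.nodup_flatMap] at h ⊢
  refine ⟨fun a ha => hg a ha (h.1 a ha), h.2.imp_of_mem fun ha hb hab => ?_⟩
  exact fun v hv hv' => hab (hgf _ ha hv) (hgf _ hb hv')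

theorem exists_prefix_of_length_le_one {l : List (ι × ι)} (hl : l.length ≤ 1) :
    ∃ E, Realizes (l.flatMap fun p => [p.1, p.2]) E 1 l.length ∧
      ∀ x, (∀ v ∈ l.map Prod.snd, x v = false) →
        (∀ v ∉ l.map Prod.snd, E x v = x v) ∧ IsPrefix l true (E x) := by
  match l, hl with
  | [], _ => exact ⟨id, Realizes.id.mono (List.nil_subset _) (by simp) le_rfl, by simp [IsPrefix]⟩
  | [p], _ =>
    refine ⟨_, (realizes_not p.2).mono (by simp) le_rfl le_rfl, fun x hx => ⟨fun v hv => ?_, ?_⟩⟩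
    · exact toggle_apply_of_ne (by simpa using hv) x
    · simpa [IsPrefix] using hx

theorem isPrefix_step {ι : Type*} {B : List ((ι × ι) × ι × ι)} {r : List (ι × ι)}
    {F G E : State ι → State ι} {S T : List ι} (hS : S = B.map (fun b => b.1.2) ++ r.map Prod.snd)
    (hT : T = B.map fun b => b.2.2) (hST : S.Disjoint T)
    (hfst : ∀ p ∈ B.flatMap (fun b => [b.1, b.2]) ++ r, p.1 ∉ S ++ T)
    (hF : ∀ x, ∀ v ∉ T, F x v = x v)
    (hFB : ∀ b ∈ B, ∀ x, F x b.2.2 = (x b.2.2 ^^ (x b.1.1 && x b.2.1)))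
    (hG : ∀ x, ∀ v ∉ T, G x v = x v)
    (hGB : ∀ b ∈ B, ∀ x, G x b.2.2 = (x b.2.2 ^^ (x b.1.1 && x b.1.2)))
    (hE : ∀ x, (∀ v ∈ S, x v = false) → (∀ v ∉ S, E x v = x v) ∧
      IsPrefix (B.map (fun b => (b.2.2, b.1.2)) ++ r) true (E x))
    {x : State ι} (hx : ∀ v ∈ S ++ T, x v = false) :
    (∀ v ∉ S ++ T, G (F (E (F x))) v = x v) ∧
      IsPrefix (B.flatMap (fun b => [b.1, b.2]) ++ r) true (G (F (E (F x)))) := by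
  obtain ⟨hEo, hprefix⟩ := hE (F x) fun v hv =>
    (hF x v (hST hv)).trans (hx v (List.mem_append_left T hv))
  have hout {v : ι} (hv : v ∉ S ++ T) : E (F x) v = x v ∧ G (F (E (F x))) v = x v := by
    rw [List.mem_append, not_or] at hv
    rw [hG _ v hv.2, hF _ v hv.2, hEo v hv.1, hF _ v hv.2, and_self]
  have hSx {v : ι} (hv : v ∈ S) : G (F (E (F x))) v = E (F x) v := by
    rw [hG _ v (hST hv), hF _ v (hST hv)]
  refine ⟨fun v hv => (hout hv).2, isPrefix_flatMap_pair_append (fun b hb => ?_)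
    (fun p hp => ⟨?_, ?_⟩) hprefix⟩
  · have hcT : b.2.2 ∈ T := hT ▸ List.mem_map_of_mem hb
    have hcS : b.1.2 ∈ S := hS ▸ List.mem_append_left _ (List.mem_map_of_mem hb)
    have hEc : E (F x) b.2.2 = (x b.1.1 && x b.2.1) := by
      rw [hEo _ fun h => hST h hcT, hFB b hb, hx _ (List.mem_append_right S hcT), Bool.false_xor]
    have hFT {v : ι} (hv : v ∉ S ++ T) : F (E (F x)) v = x v := by
      rw [hF _ v fun h => hv (List.mem_append_right S h), (hout hv).1]
    have hb₁ : b.1.1 ∉ S ++ T :=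
      hfst _ (List.mem_append_left r (List.mem_flatMap_of_mem hb List.mem_cons_self))
    have hb₂ : b.2.1 ∉ S ++ T :=
      hfst _ (List.mem_append_left r (List.mem_flatMap_of_mem hb (by simp)))
    refine ⟨by rw [hEc, (hout hb₁).2, (hout hb₂).2], hSx hcS, ?_⟩
    rw [hGB b hb, hFB b hb, hEc, (hout hb₁).1, (hout hb₂).1, hFT hb₁, hF _ _ (hST hcS), hSx hcS,
      (hout hb₁).2]
    simp [Bool.and_comm]
  · have hpx := hout (hfst p (List.mem_append_right _ hp))
    rw [hpx.1, hpx.2]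
  · exact hSx (hS ▸ List.mem_append_right _ (List.mem_map_of_mem hp))

/-
  Brent–Kung: combine neighbouring wires, recurse on the half-size list, then undo the combination.
-/
theorem exists_prefix (K : ℕ) {l : List (ι × ι)} (hl : l.length ≤ 2 ^ K)
    (h : (l.flatMap fun p => [p.1, p.2]).Nodup) :
    ∃ E, Realizes (l.flatMap fun p => [p.1, p.2]) E (3 * K + 1) (3 * l.length) ∧
      ∀ x, (∀ v ∈ l.map Prod.snd, x v = false) →
        (∀ v ∉ l.map Prod.snd, E x v = x v) ∧ IsPrefix l true (E x) := by
  induction K generalizing l with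
  | zero =>
    obtain ⟨E, hE, hEx⟩ := exists_prefix_of_length_le_one hl
    exact ⟨E, hE.mono (List.Subset.refl _) (by lia) (by lia), hEx⟩
  | succ K ih =>
    obtain ⟨B, r, rfl, hr⟩ := exists_flatMap_pair_append l
    have hlen : (B.flatMap (fun b => [b.1, b.2]) ++ r).length = B.length * 2 + r.length := by simp
    rw [hlen] at hl ⊢
    have hperm := map_snd_flatMap_pair_append_perm B r
    obtain ⟨-, hsnd, hdisj⟩ := List.nodup_append'.1 ((flatMap_pair_perm _ _ _).nodup_iff.1 h)
    have hfst (p : ι × ι) (hp : p ∈ B.flatMap (fun b => [b.1, b.2]) ++ r) :=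
      mt hperm.mem_iff.2 (hdisj (List.mem_map_of_mem hp))
    simp only [List.flatMap_append, List.flatMap_assoc, List.flatMap_cons, List.flatMap_nil,
      List.append_nil, List.cons_append, List.nil_append] at h ⊢
    obtain ⟨hB, hr', hBr⟩ := List.nodup_append'.1 h
    obtain ⟨F, hF, hFo, hFB⟩ := exists_toffoliLayer B (fun b => b.1.1) (fun b => b.2.1)
      (fun b => b.2.2) (nodup_flatMap_of_subset hB (by grind) (by simp))
    obtain ⟨G, hG, hGo, hGB⟩ := exists_toffoliLayer B (fun b => b.1.1) (fun b => b.1.2)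
      (fun b => b.2.2) (nodup_flatMap_of_subset hB (by grind) (by simp))
    have hB' : (B.flatMap fun b => [b.2.2, b.1.2]) ⊆
        B.flatMap fun b => [b.1.1, b.1.2, b.2.1, b.2.2] := flatMap_subset_flatMap (by simp)
    obtain ⟨E, hE, hEx⟩ := @ih (B.map (fun b => (b.2.2, b.1.2)) ++ r)
      (by rw [List.length_append, List.length_map]; lia) (by
      rw [List.flatMap_append, List.flatMap_map, List.nodup_append']
      exact ⟨nodup_flatMap_of_subset hB (by grind) (by simp), hr', fun v hv => hBr (hB' hv)⟩)
    refine ⟨_, (hG.comp (hF.comp (hE.comp hF))).mono ?_ (by lia) ?_, fun x hx => ?_⟩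
    · simp only [List.flatMap_append, List.flatMap_map, List.append_subset]
      have hsub {f : (ι × ι) × ι × ι → List ι} (hf : ∀ b ∈ B, f b ⊆ [b.1.1, b.1.2, b.2.1, b.2.2]) :=
        List.subset_append_of_subset_left (r.flatMap fun p => [p.1, p.2])
          (flatMap_subset_flatMap hf)
      exact ⟨hsub (by simp), hsub (by simp), ⟨hsub (by simp), List.subset_append_right _ _⟩,
        hsub (by simp)⟩
    · rw [List.length_append, List.length_map]
      lia
    · simp only [List.map_append, List.map_map, comp_def] at hEx
      simp only [hperm.mem_iff] at hx ⊢
      exact isPrefix_step rfl rfl (List.disjoint_of_nodup_append (hperm.nodup_iff.1 hsnd)) hfst hFo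
        hFB hGo hGB hEx hx

theorem IsPrefix.apply_snd_eq {ι : Type*} {l : List (ι × ι)} {a : Bool} {x y : State ι}
    (hx : IsPrefix l a x) (hy : IsPrefix l a y) (h : ∀ p ∈ l, x p.1 = y p.1) :
    ∀ p ∈ l, x p.2 = y p.2 := by
  induction l generalizing a with
  | nil => simp
  | cons p l ih =>
    rw [List.forall_mem_cons] at h ⊢
    exact ⟨hx.1.trans hy.1.symm, ih hx.2 (h.1 ▸ hy.2) h.2⟩

theorem IsPrefix.of_complement {ι : Type*} {l : List (ι × ι)} {a : Bool} {x y : State ι}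
    (hx : IsPrefix l a x) (h : ∀ p ∈ l, y p.1 = !(x p.1 ^^ x p.2) ∧ y p.2 = x p.2) :
    IsPrefix l a y := by
  induction l generalizing a with
  | nil => trivial
  | cons p l ih =>
    rw [List.forall_mem_cons] at h
    obtain ⟨rfl, hl⟩ := hx
    have hp : (x p.2 && y p.1) = (x p.2 && x p.1) := by
      rw [h.1.1]
      cases x p.1 <;> cases x p.2 <;> rfl
    exact ⟨h.1.2, hp ▸ ih hl h.2⟩

theorem inc_eq_of_isPrefix {l : List (ι × ι)} {a : Bool} {x y : State ι}
    (hl : (l.map Prod.fst).Nodup) (hx : IsPrefix l a x)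
    (hyo : ∀ v ∉ l.map Prod.fst, y v = x v) (hy : ∀ p ∈ l, y p.1 = (x p.1 ^^ x p.2)) :
    y = if a then inc (l.map Prod.fst) x else x := by
  induction l generalizing a y with
  | nil =>
    have : y = x := funext fun v => hyo v (by simp)
    simp [this, inc]
  | cons p l ih =>
    obtain ⟨rfl, hx⟩ := hx
    rw [List.map_cons, List.nodup_cons] at hl
    rw [List.forall_mem_cons] at hy
    have hrest := @ih (x p.2 && x p.1) (update y p.1 (x p.1)) hl.2 hx (fun v hv => by
      by_cases hvp : v = p.1
      · rw [hvp, update_self]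
      · rw [update_of_ne hvp, hyo v (by simp_all)]) fun r hr => by
        have hrp : r.1 ≠ p.1 := fun hrp => hl.1 (hrp ▸ List.mem_map_of_mem hr)
        rw [update_of_ne hrp, hy.2 r hr]
    have hyp : y = update (update y p.1 (x p.1)) p.1 (x p.1 ^^ x p.2) := by
      rw [update_idem, ← hy.1, update_eq_self]
    rw [hyp, hrest, List.map_cons, inc]
    cases x p.2
    · simp
    · cases x p.1 <;> simp

theorem exists_controlledCnotLayer {α : Type*} (K : ℕ) {q : ι} {l : List α} {t c g : α → ι}
    (hl : l.length ≤ 2 ^ K) (h : (q :: (l.map t ++ (l.map c ++ l.map g))).Nodup) :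
    ∃ F, Realizes (q :: (l.map t ++ (l.map c ++ l.map g))) F (4 * K + 4) (6 * l.length) ∧
      (∀ x, ∀ v ∉ l.map t, F x v = x v) ∧
      ∀ a ∈ l, ∀ x, F x (t a) = (x (t a) ^^ (x q && x (c a))) := by
  obtain ⟨hq, hnodup⟩ := List.nodup_cons.1 h
  simp only [List.mem_append, not_or] at hq
  have hperm : (l.flatMap fun a => [c a, g a, t a]).Perm (l.map t ++ (l.map c ++ l.map g)) :=
    (flatMap_triple_perm l c g t).trans (by
      rw [← List.append_assoc]
      exact List.perm_append_comm)
  have htcg : (l.map t ++ l.map c).Disjoint (l.map g) :=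
    List.disjoint_of_nodup_append (by rwa [List.append_assoc])
  have ht := List.disjoint_of_nodup_append hnodup
  obtain ⟨T, hT, hTo, hTt⟩ := exists_toffoliLayer l c g t (hperm.nodup_iff.2 hnodup)
  have he := realizes_fanout K (q := q) (l := l.map g) (by simpa using hl)
    (List.nodup_cons.2 ⟨hq.2.2, hnodup.of_append_right.of_append_right⟩)
  refine ⟨_, (he.comp (hT.comp (he.comp hT))).mono ?_ (by lia) (by grind), fun x v hv => ?_,
    fun a ha x => ?_⟩
  · have hTl := List.subset_cons_of_subset q hperm.subset
    have hel : q :: l.map g ⊆ q :: (l.map t ++ (l.map c ++ l.map g)) :=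
      List.cons_subset_cons q (by simp)
    exact List.append_subset.2 ⟨hel, List.append_subset.2 ⟨hTl, List.append_subset.2 ⟨hel, hTl⟩⟩⟩
  · simp only [comp_apply, hTo _ q hq.1, flipOn_of_notMem hq.2.2]
    by_cases hvg : v ∈ l.map g
    · simp [flipOn_of_mem hvg, hTo _ v hv]
    · simp [flipOn_of_notMem hvg, hTo _ v hv]
  · have hga : g a ∈ l.map g := List.mem_map_of_mem ha
    have hgt : g a ∉ l.map t := fun h => ht h (List.mem_append_right _ hga)
    have hca : c a ∈ l.map c := List.mem_map_of_mem ha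
    have hct : c a ∉ l.map t := fun h => ht h (List.mem_append_left _ hca)
    have hta : t a ∉ l.map g := htcg (List.mem_append_left _ (List.mem_map_of_mem ha))
    have hcg : c a ∉ l.map g := htcg (List.mem_append_right _ hca)
    simp only [comp_apply, hTo _ q hq.1, hTo _ _ hgt, hTo _ _ hct, hTt a ha,
      flipOn_of_notMem hq.2.2, flipOn_of_notMem hta, flipOn_of_notMem hcg, flipOn_of_mem hga]
    cases x (g a) <;> cases x (c a) <;> simp

/- Complementing a register after its increment preserves the carries: where the carry is set, the
bit has been flipped twice. -/
theorem flipOn_inc_eq_of_isPrefix {l : List (ι × ι)} (h : (l.map Prod.fst ++ l.map Prod.snd).Nodup)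
    {E m : State ι → State ι} (hE : ∀ x, (∀ v ∈ l.map Prod.snd, x v = false) →
      (∀ v ∉ l.map Prod.snd, E x v = x v) ∧ IsPrefix l true (E x))
    {x : State ι} (hx : ∀ v ∈ l.map Prod.snd, x v = false)
    (hmo : ∀ v ∉ l.map Prod.fst, m (E x) v = E x v)
    (hm : ∀ p ∈ l, m (E x) p.1 = (E x p.1 ^^ E x p.2)) :
    E (flipOn (l.map Prod.fst) true (inc (l.map Prod.fst) x)) =
      flipOn (l.map Prod.fst) true (m (E x)) := by
  obtain ⟨hnodup, -, hdisj⟩ := List.nodup_append'.1 h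
  obtain ⟨hEo, hEp⟩ := hE x hx
  have hmE : m (E x) = inc (l.map Prod.fst) (E x) := inc_eq_of_isPrefix hnodup hEp hmo hm
  obtain ⟨hFo, hFp⟩ := hE (flipOn (l.map Prod.fst) true (inc (l.map Prod.fst) x)) fun v hv => by
    rw [flipOn_of_notMem fun h => hdisj h hv, inc_of_notMem fun h => hdisj h hv, hx v hv]
  have hGp : IsPrefix l true (flipOn (l.map Prod.fst) true (m (E x))) := by
    refine hEp.of_complement fun p hp => ?_
    have hp₂ : p.2 ∉ l.map Prod.fst := fun h => hdisj h (List.mem_map_of_mem hp)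
    rw [flipOn_of_mem (List.mem_map_of_mem hp), hm p hp, flipOn_of_notMem hp₂, hmo _ hp₂,
      Bool.xor_true]
    exact ⟨rfl, rfl⟩
  have hfst {v : ι} (hv : v ∈ l.map Prod.fst) :
      E (flipOn (l.map Prod.fst) true (inc (l.map Prod.fst) x)) v =
        flipOn (l.map Prod.fst) true (m (E x)) v := by
    rw [hFo v (hdisj hv), flipOn_of_mem hv, flipOn_of_mem hv, hmE,
      (localOn_inc _).congr (E x) x (fun u hu => hEo u (hdisj hu)) v hv]
  funext v
  by_cases hv : v ∈ l.map Prod.fst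
  · exact hfst hv
  · by_cases hv₂ : v ∈ l.map Prod.snd
    · obtain ⟨p, hp, rfl⟩ := List.mem_map.1 hv₂
      exact hFp.apply_snd_eq hGp (fun p hp => hfst (List.mem_map_of_mem hp)) p hp
    · rw [hFo v hv₂, flipOn_of_notMem hv, flipOn_of_notMem hv, inc_of_notMem hv, hmo v hv,
        hEo v hv₂]

/-- The map `f` increments the register `l` if the bit of `q` is set and does nothing otherwise,
provided that its workspace is prepared: the wires of `Q` must hold zeros, and so must those of `W`
whenever the bit of `q` is set. -/
def IsControlledInc (q : ι) (Q W l : List ι) (f : State ι → State ι) : Prop :=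
  ∀ x, (∀ v ∈ Q, x v = false) → (x q = false → f x = x) ∧
    (x q = true → (∀ v ∈ W, x v = false) → f x = inc l x)

theorem exists_controlledInc_of_map {α : Type*} (K : ℕ) {q : ι} {l : List α} {t c g : α → ι}
    (hl : l.length ≤ 2 ^ K) (h : (q :: (l.map t ++ (l.map c ++ l.map g))).Nodup) :
    ∃ f, Realizes (q :: (l.map t ++ (l.map c ++ l.map g))) f (14 * K + 8) (16 * l.length) ∧
      IsControlledInc q [] (l.map c) (l.map t) f := by
  obtain ⟨hq, hnodup⟩ := List.nodup_cons.1 h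
  simp only [List.mem_append, not_or] at hq
  have htc : (l.map t ++ l.map c).Nodup := List.Nodup.of_append_left (by rwa [List.append_assoc])
  obtain ⟨E, hE, hEx⟩ := exists_prefix K (l := l.map fun a => (t a, c a)) (by simpa using hl)
    (by rwa [List.flatMap_map, (flatMap_pair_perm l t c).nodup_iff])
  simp only [List.flatMap_map, List.length_map] at hE
  have hfst : (l.map fun a => (t a, c a)).map Prod.fst = l.map t := by simp
  have hsnd : (l.map fun a => (t a, c a)).map Prod.snd = l.map c := by simp
  have hperm := flatMap_pair_perm l t c
  have he := realizes_fanout K (q := q) (l := l.map t) (by simpa using hl)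
    (List.nodup_cons.2 ⟨hq.1, hnodup.of_append_left⟩)
  obtain ⟨m, hm, hmo, hmt⟩ := exists_controlledCnotLayer K hl h
  obtain ⟨f, hf, hEf⟩ := hE.exists_semiconj (he.comp hm)
  have hEq (x : State ι) : E x q = x q :=
    hE.apply_of_notMem (by rw [hperm.mem_iff]; simp [hq]) x
  refine ⟨_, (he.comp hf).mono ?_ (by lia) (by grind), fun x _ =>
    ⟨fun hx => ?_, fun hx hc => ?_⟩⟩
  · have := hperm.subset
    grind
  · have hmE : m (E x) = E x := funext fun v => by
      by_cases hv : v ∈ l.map t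
      · obtain ⟨a, ha, rfl⟩ := List.mem_map.1 hv
        rw [hmt a ha, hEq, hx, Bool.false_and, Bool.xor_false]
      · exact hmo _ v hv
    have hfx : f x = x := hE.injective (by simp [hEf x, hmE, hEq, hx])
    simp [hfx, hx]
  · have hmq : m (E x) q = true := by rw [hmo _ q hq.1, hEq, hx]
    have hfx : f x = flipOn (l.map t) true (inc (l.map t) x) := hE.injective (by
      have := flipOn_inc_eq_of_isPrefix (by rwa [hfst, hsnd]) hEx (m := m) (by rwa [hsnd])
        (by rw [hfst]; exact hmo _) (by simpa [hEq, hx] using fun a ha => hmt a ha (E x))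
      rw [hfst] at this
      rw [this, hEf x, comp_apply, hmq])
    simp [hfx, flipOn_of_notMem hq.1, inc_of_notMem hq.1, hx]

theorem exists_controlledInc (K : ℕ) {q : ι} {l W : List ι} (hW : 2 * l.length ≤ W.length)
    (hl : l.length ≤ 2 ^ K) (h : (q :: (l ++ W)).Nodup) :
    ∃ f, Realizes (q :: (l ++ W)) f (14 * K + 8) (16 * l.length) ∧
      IsControlledInc q [] W l f := by
  obtain ⟨C, G, R, rfl, hC, hG⟩ : ∃ C G R, W = C ++ (G ++ R) ∧ C.length = l.length ∧
      G.length = l.length :=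
    ⟨W.take l.length, (W.drop l.length).take l.length, (W.drop l.length).drop l.length,
      by simp only [List.take_append_drop], by grind, by grind⟩
  have ht : (l.zip (C.zip G)).map Prod.fst = l := List.map_fst_zip (by simp [hC, hG])
  have hsnd : (l.zip (C.zip G)).map Prod.snd = C.zip G := List.map_snd_zip (by simp [hC])
  have hc : (l.zip (C.zip G)).map (fun a => a.2.1) = C :=
    (List.map_map (f := Prod.snd) (g := Prod.fst)).symm.trans (by
      rw [hsnd, List.map_fst_zip (by lia)])
  have hg : (l.zip (C.zip G)).map (fun a => a.2.2) = G :=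
    (List.map_map (f := Prod.snd) (g := Prod.snd)).symm.trans (by
      rw [hsnd, List.map_snd_zip (by lia)])
  have hsub : l ++ (C ++ G) ⊆ l ++ (C ++ (G ++ R)) := by
    simp [← List.append_assoc]
  obtain ⟨f, hf, hfl⟩ := exists_controlledInc_of_map K (q := q) (l := l.zip (C.zip G))
    (t := Prod.fst) (c := fun a => a.2.1) (g := fun a => a.2.2) (by simpa [hC, hG] using hl)
    (by simp only [ht, hc, hg]; grind)
  simp only [ht, hc, hg] at hf hfl
  exact ⟨f, hf.mono (List.cons_subset_cons q hsub) le_rfl (by simp [hC, hG]), fun x hx =>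
    ⟨(hfl x hx).1, fun hq hW => (hfl x hx).2 hq fun v hv => hW v (List.mem_append_left _ hv)⟩⟩

/- Where `k` carries into `q'`, it leaves zeros in `F`: these are workspace for `g`. -/
theorem IsControlledInc.apply_of_semiconj {q q' : ι} {Q W F H : List ι}
    {c g k : State ι → State ι} (h : (q :: q' :: (Q ++ (W ++ (F ++ H)))).Nodup)
    (hk : IsControlledInc q [] W (F ++ [q']) k) (hki : Injective k)
    (hg : IsControlledInc q' Q (W ++ F) H g) (hc : Semiconj k c g) {x : State ι} (hq : x q = true)
    (hq' : x q' = false) (hQ : ∀ v ∈ Q, x v = false) (hW : ∀ v ∈ W, x v = false) :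
    c x = if F.all x then inc H x else x := by
  simp only [List.nodup_cons, List.nodup_append', List.mem_cons, List.mem_append, not_or,
    List.disjoint_append_right] at h
  obtain ⟨⟨-, -, -, -, hqH⟩, ⟨hq'Q, hq'W, hq'F, hq'H⟩, -,
    ⟨-, ⟨-, -, hFH⟩, hWF, hWH⟩, -, hQF, -⟩ := h
  have hkx : k x = inc (F ++ [q']) x := (hk x (by simp)).2 hq hW
  have hkq' : k x q' = F.all x := by
    rw [hkx, inc_append_singleton hq'F, inc_of_notMem hq'F, toggle_apply_self, hq',
      Bool.false_xor]
  have hkQ : ∀ v ∈ Q, k x v = false := fun v hv => by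
    have hvF : v ∉ F := hQF hv
    rw [hkx, inc_of_notMem (by simp [hvF, ne_of_mem_of_not_mem hv hq'Q]), hQ v hv]
  cases hF : F.all x
  · exact hki (by rw [hc x, (hg _ hkQ).1 (hkq'.trans hF), if_neg Bool.false_ne_true])
  · have hkWF : ∀ v ∈ W ++ F, k x v = false := fun v hv => by
      rcases List.mem_append.1 hv with hv | hv
      · have hvF : v ∉ F := hWF hv
        rw [hkx, inc_of_notMem (by simp [hvF, ne_of_mem_of_not_mem hv hq'W]), hW v hv]
      · rw [hkx, inc_append_singleton hq'F, inc_apply_eq_false _ hv]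
        rw [toggle, all_update_of_notMem hq'F, hF]
    have hdisj : Disjoint {v | v ∈ F ++ [q']} {v | v ∈ H} :=
      Set.disjoint_left.2 (show (F ++ [q']).Disjoint H by simp [hFH, hq'H])
    have hkH : k (inc H x) = inc (F ++ [q']) (inc H x) :=
      (hk _ (by simp)).2 (by rw [inc_of_notMem hqH, hq]) fun v hv => by
        rw [inc_of_notMem (hWH hv), hW v hv]
    exact hki (by rw [hc x, (hg _ hkQ).2 (hkq'.trans hF) hkWF, hkx, if_pos rfl, hkH,
      (localOn_inc _).comm (localOn_inc _) hdisj])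

theorem IsControlledInc.comp_of_semiconj {q q' : ι} {Q W F H : List ι}
    {c g k k' : State ι → State ι} (h : (q :: q' :: (Q ++ (W ++ (F ++ H)))).Nodup)
    (hk : IsControlledInc q [] W F k) (hk' : IsControlledInc q [] W (F ++ [q']) k')
    (hki' : Injective k') (hg : IsControlledInc q' Q (W ++ F) H g) (hc : Semiconj k' c g) :
    IsControlledInc q (q' :: Q) W (F ++ H) (k ∘ c) := by
  refine fun x hQ => ?_
  rw [List.forall_mem_cons] at hQ
  refine ⟨fun hq => ?_, fun hq hW => ?_⟩
  · have hcx : c x = x := hki' (by rw [hc x, (hk' x (by simp)).1 hq, (hg x hQ.2).1 hQ.1])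
    rw [comp_apply, hcx, (hk x (by simp)).1 hq]
  · have hcx := hk'.apply_of_semiconj h hki' hg hc hq hQ.1 hQ.2 hW
    have hcxv {v : ι} (hv : v ∉ H) : c x v = x v := by
      rw [hcx]
      split
      · exact inc_of_notMem hv x
      · rfl
    rw [inc_append fun v => by grind, ← hcx]
    exact (hk (c x) (by simp)).2 (by rw [hcxv (by grind), hq]) fun v hv => by
      rw [hcxv (by grind), hW v hv]

/- Each carry wire in `Q` pays for a block half as long as the current workspace, and hence for an
increase of the workspace by the factor `3 / 2`. -/
theorem exists_controlledInc_of_pow (K : ℕ) {q : ι} {Q W H : List ι} {w : ℕ}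
    (hW : w + 3 ≤ W.length) (hH : H.length ≤ 2 ^ K)
    (hQ : 2 ^ Q.length * (w + H.length) ≤ 3 ^ Q.length * w)
    (h : (q :: (Q ++ (W ++ H))).Nodup) :
    ∃ f, Realizes (q :: (Q ++ (W ++ H))) f ((3 * Q.length + 1) * (14 * K + 8)) (80 * H.length) ∧
      IsControlledInc q Q W H f := by
  rcases le_or_gt (2 * H.length) (w + 1) with hHw | hHw
  · obtain ⟨f, hf, hfH⟩ := exists_controlledInc K (q := q) (l := H) (W := W) (by lia) hH (by grind)
    exact ⟨f, hf.mono (by grind) (by nlinarith) (by lia), fun x _ => hfH x (by simp)⟩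
  have hw : 0 < w := Nat.pos_of_ne_zero fun hw => by
    simp only [hw, zero_add, mul_zero, Nat.le_zero, mul_eq_zero, pow_eq_zero_iff'] at hQ
    lia
  cases Q with
  | nil =>
    simp only [List.length_nil, pow_zero, one_mul] at hQ
    lia
  | cons q' Q =>
    obtain ⟨F, H, rfl, hF⟩ : ∃ F H', H = F ++ H' ∧ F.length = (w + 1) / 2 :=
      ⟨H.take ((w + 1) / 2), H.drop ((w + 1) / 2), by simp, by grind⟩
    simp only [List.length_append, List.length_cons] at *
    obtain ⟨g, hg, hgH⟩ := exists_controlledInc_of_pow K (q := q') (Q := Q) (W := W ++ F) (H := H)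
      (w := w + F.length) (by grind) (by lia) (by
        have := Nat.mul_le_mul_left (3 ^ Q.length) (show 3 * w ≤ 2 * (w + F.length) by lia)
        rw [pow_succ, pow_succ] at hQ
        lia) (by grind)
    obtain ⟨k, hk, hkF⟩ := exists_controlledInc K (q := q) (l := F) (W := W) (by lia) (by lia)
      (by grind)
    obtain ⟨k', hk', hkF'⟩ := exists_controlledInc K (q := q) (l := F ++ [q']) (W := W)
      (by grind) (by grind) (by grind)
    obtain ⟨c, hc, hkc⟩ := hk'.exists_semiconj hg
    refine ⟨k ∘ c, (hk.comp hc).mono (by grind) (by lia) ?_,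
      hkF.comp_of_semiconj (by grind) hkF' hk'.injective hgH hkc⟩
    simp only [List.length_append, List.length_singleton]
    lia
termination_by Q.length

theorem two_pow_mul_succ_le {K m : ℕ} (hm : m ≤ 2 ^ K) :
    2 ^ (2 * K + 2) * (1 + m) ≤ 3 ^ (2 * K + 2) * 1 := by
  have hm' : 1 + m ≤ 2 ^ (K + 1) := by
    have := Nat.one_le_two_pow (n := K)
    lia
  calc 2 ^ (2 * K + 2) * (1 + m) ≤ (2 ^ 2) ^ (K + 1) * 2 ^ (K + 1) := by
        rw [← pow_mul, mul_add_one]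
        gcongr
    _ = 8 ^ (K + 1) := by rw [← mul_pow]; norm_num
    _ ≤ 9 ^ (K + 1) := by gcongr; simp
    _ = 3 ^ (2 * K + 2) * 1 := by rw [mul_one, ← mul_add_one, pow_mul]; norm_num

theorem exists_controlledInc_of_all (K : ℕ) {q : ι} {A H : List ι} (hA : A.length = 2 * K + 6)
    (hH : H.length ≤ 2 ^ K) (h : (q :: (A ++ H)).Nodup) :
    ∃ F, Realizes (q :: (A ++ H)) F ((6 * K + 7) * (14 * K + 8) + 2)
        (80 * H.length + 4 * K + 12) ∧
      ∀ x, A.all x = true → F x = if x q then inc H x else x := by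
  obtain ⟨Q, W, rfl, hQ⟩ : ∃ Q W, A = Q ++ W ∧ Q.length = 2 * K + 2 :=
    ⟨A.take (2 * K + 2), A.drop (2 * K + 2), by simp, by grind⟩
  have hW : W.length = 4 := by grind
  obtain ⟨g, hg, hgH⟩ := exists_controlledInc_of_pow K (q := q) (Q := Q) (W := W) (H := H) (w := 1)
    (by lia) hH (hQ ▸ two_pow_mul_succ_le hH) (by grind)
  have hN := realizes_flipOn (l := Q ++ W) (by grind)
  refine ⟨_, (hN.comp (hg.comp hN)).mono (by grind) (by rw [hQ]; lia) (by rw [hA]; lia),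
    fun x hx => ?_⟩
  have hqA : q ∉ Q ++ W := by grind
  have hzero : ∀ v ∈ Q ++ W, flipOn (Q ++ W) true x v = false := fun v hv => by
    rw [flipOn_of_mem hv, List.all_eq_true.1 hx v hv, Bool.xor_self]
  obtain ⟨hg₀, hg₁⟩ := hgH (flipOn (Q ++ W) true x) fun v hv => hzero v (by simp [hv])
  rw [flipOn_of_notMem hqA] at hg₀ hg₁
  simp only [comp_apply]
  cases hq : x q
  · rw [hg₀ hq, flipOn_flipOn, if_neg Bool.false_ne_true]
  · rw [hg₁ hq fun v hv => hzero v (by simp [hv]), if_pos rfl,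
      ← (localOn_flipOn _ _).comm (localOn_inc H) (Set.disjoint_left.2 fun v => by grind),
      flipOn_flipOn]

theorem inc_eq_of_semiconj {b : ι} {A H : List ι} {F c : State ι → State ι}
    (h : (b :: (A ++ H)).Nodup) (hFs : Surjective F)
    (hF : ∀ x, A.all x = true → F x = if x b then inc H x else x)
    (hc : Semiconj F (toggle b A.all) c) {e : State ι → State ι}
    (he : ∀ x, e x = flipOn H (x b) x) (x : State ι) :
    e (toggle b A.all (c (e x))) = if A.all x then inc H x else x := by
  have hbA : b ∉ A := by grind
  have hbH : b ∉ H := by grind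
  have hAH : ∀ v ∈ A, v ∉ H := by grind
  have hincA (y : State ι) : A.all (inc H y) = A.all y :=
    all_congr_of_eqOn fun v hv => inc_of_notMem (hAH v hv) y
  have hflipA (y : State ι) (a : Bool) : A.all (flipOn H a y) = A.all y :=
    all_congr_of_eqOn fun v hv => flipOn_of_notMem (hAH v hv) a y
  cases hx : A.all x
  · obtain ⟨z, hz⟩ := hFs (e x)
    have hex : A.all (e x) = false := by rw [he, hflipA, hx]
    have hzA : A.all z = false := by
      by_contra hne
      rw [Bool.not_eq_false] at hne
      have hFz : A.all (F z) = true := by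
        rw [hF z hne]
        split
        exacts [(hincA z).trans hne, hne]
      rw [hz, hex] at hFz
      exact Bool.false_ne_true hFz
    rw [← hz, ← hc z, toggle_of_eq_false hzA, hz, toggle_of_eq_false hex]
    simp [he, flipOn_of_notMem hbH]
  · cases hb : x b
    · have hex : e x = F x := by simp [he, hF x hx, hb]
      rw [hex, ← hc x, hF _ (by rw [toggle, all_update_of_notMem hbA, hx])]
      simp [toggle, hx, hb, he, hincA, inc_of_notMem hbH, (localOn_inc H).apply_update hbH,
        all_update_of_notMem hbA]
    · have hzb : flipOn H true (inc H x) b = true := by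
        rw [flipOn_of_notMem hbH, inc_of_notMem hbH, hb]
      have hzA : A.all (flipOn H true (inc H x)) = true := by rw [hflipA, hincA, hx]
      have hz : update (flipOn H true (inc H x)) b true = flipOn H true (inc H x) :=
        update_eq_self_iff.2 hzb.symm
      have hex : e x = F (flipOn H true (inc H x)) := by
        rw [hF _ hzA, he, hb, if_pos hzb, inc_flipOn_inc (by grind)]
      rw [hex, ← hc, hF _ (by rw [toggle, all_update_of_notMem hbA, hzA])]
      simp [toggle, he, hzA, hzb, all_update_of_notMem hbA, hz]

theorem realizes_inc_of_all (K : ℕ) {b : ι} {A H : List ι} (hA : A.length = 2 * K + 6)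
    (hH : H.length ≤ 2 ^ K) (h : (b :: (A ++ H)).Nodup) :
    Realizes (b :: (A ++ H)) (fun x => if A.all x then inc H x else x) (250 * (K + 1) ^ 2)
      (164 * H.length + 200 * (K + 1) ^ 2) := by
  cases H with
  | nil =>
    exact (Realizes.id.mono (List.nil_subset _) (Nat.zero_le _) (Nat.zero_le _)).congr
      fun x => by simp [inc]
  | cons d H =>
    obtain ⟨F, hF, hFA⟩ := exists_controlledInc_of_all K hA hH h
    have hm := realizes_toggle_all (t := b) (d := d) (cs := A) (by grind)
    have he := realizes_fanout K (q := b) (l := d :: H) hH (by grind)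
    obtain ⟨c, hc, hFc⟩ := hF.exists_semiconj' hm
    refine ((he.comp (hm.comp (hc.comp he))).mono (by grind) ?_ ?_).congr fun x =>
      (inc_eq_of_semiconj h hF.surjective hFA hFc (fun _ => rfl) x).symm
    · rw [hA]
      nlinarith
    · rw [hA]
      nlinarith

theorem realizes_inc (K : ℕ) {b : ι} {l : List ι} (hl : l.length ≤ 2 ^ K) (h : (b :: l).Nodup) :
    Realizes (b :: l) (inc l) (650 * (K + 1) ^ 2) (164 * l.length + 650 * (K + 1) ^ 2) := by
  rcases lt_or_ge l.length (2 * K + 6) with hlK | hlK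
  · have : l.length * (8 * l.length + 16) ≤ 650 * (K + 1) ^ 2 := by nlinarith
    exact (realizes_inc_quadratic h).mono (List.Subset.refl _) this
      (this.trans (Nat.le_add_left _ _))
  · obtain ⟨A, H, rfl, hA⟩ : ∃ A H, l = A ++ H ∧ A.length = 2 * K + 6 :=
      ⟨l.take (2 * K + 6), l.drop (2 * K + 6), by simp, by grind⟩
    rw [List.length_append] at hl ⊢
    have hf := realizes_inc_of_all K hA (by lia) h
    have hg := realizes_inc_quadratic (d := b) (l := A) (by grind)
    refine ((hg.comp hf).mono (by grind) ?_ ?_).congr fun x =>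
      inc_append (List.disjoint_of_nodup_append h.of_cons) x
    · rw [hA]
      nlinarith
    · rw [hA]
      nlinarith

theorem basisOp_mul [Fintype ι] (f g : State ι → State ι) :
    basisOp f * basisOp g = basisOp (f ∘ g) := by
  ext y x
  simp [basisOp, Matrix.mul_apply]

theorem basisOp_id [Fintype ι] : basisOp (id : State ι → State ι) = 1 := by
  ext y x
  simp [basisOp, Matrix.one_apply]

theorem foldl_op_mul_basisOp [Fintype ι] (L : List (Gate ι)) (f : State ι → State ι) :
    L.foldl (fun M g => g.op * M) (basisOp f) = basisOp (run L ∘ f) := by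
  induction L generalizing f with
  | nil => rfl
  | cons g L ih =>
    rw [List.foldl_cons, Gate.op, basisOp_mul, ih]
    rfl

theorem Circuit.op_eq_basisOp [Fintype ι] (C : Circuit ι) :
    C.op = basisOp (run C.layers.flatten) := by
  rw [Circuit.op, ← basisOp_id, foldl_op_mul_basisOp, comp_id]

theorem Circuit.implementsWithDirty_basisOp {α β : Type*} [Fintype α] [DecidableEq α] [Fintype β]
    [DecidableEq β] {C : Circuit (α ⊕ β)} {u : State α → State α}
    (hα : ∀ x, run C.layers.flatten x ∘ Sum.inl = u (x ∘ Sum.inl))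
    (hβ : ∀ x, run C.layers.flatten x ∘ Sum.inr = x ∘ Sum.inr) :
    C.ImplementsWithDirty (basisOp u) := by
  rw [ImplementsWithDirty, op_eq_basisOp]
  ext y x
  have hxy : y = run C.layers.flatten x ↔
      y ∘ Sum.inl = u (x ∘ Sum.inl) ∧ y ∘ Sum.inr = x ∘ Sum.inr := by
    rw [← hα, ← hβ x]
    simp [funext_iff]
  simp only [basisOp, Matrix.of_apply, Matrix.submatrix_apply, Matrix.kronecker,
    Matrix.kroneckerMap_apply, Matrix.one_apply, ite_zero_mul_ite_zero, one_mul]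
  exact if_congr hxy rfl rfl

theorem inc_map_comp {α : Type*} [DecidableEq α] {e : α → ι} (he : Injective e) (l : List α)
    (x : State ι) : inc (l.map e) x ∘ e = inc l (x ∘ e) := by
  induction l with
  | nil => rfl
  | cons a l ih =>
    rw [List.map_cons, inc, inc, update_comp_eq_of_injective _ he, ← ih]
    cases hx : x (e a) <;> simp [hx]

theorem ofBits_inc_finRange {n : ℕ} (x : State (Fin n)) :
    Nat.ofBits (inc (List.finRange n) x) = (Nat.ofBits x + 1) % 2 ^ n := by
  induction n with
  | zero => simp
  | succ n ih =>
    have htail : inc (List.finRange (n + 1)) x ∘ Fin.succ =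
        if x 0 then inc (List.finRange n) (x ∘ Fin.succ) else x ∘ Fin.succ := by
      rw [List.finRange_succ, inc, ← inc_map_comp (Fin.succ_injective n)]
      cases x 0 <;> rfl
    have hlt := Nat.ofBits_lt_two_pow (x ∘ Fin.succ)
    rw [Nat.ofBits_succ, Nat.ofBits_succ, htail, List.finRange_succ, inc, update_self, pow_succ']
    cases x 0
    · rw [if_neg Bool.false_ne_true, Bool.not_false, Bool.toNat_true, Bool.toNat_false, add_zero,
        Nat.mod_eq_of_lt (by lia)]
    · rw [if_pos rfl, ih, Bool.not_true, Bool.toNat_false, Bool.toNat_true, add_zero, add_assoc,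
        ← mul_add_one, Nat.mul_mod_mul_left]

theorem ofBits_injective {n : ℕ} : Injective (Nat.ofBits : State (Fin n) → ℕ) := fun x y h => by
  funext i
  simpa [Nat.testBit_ofBits_lt] using congrArg (fun m => m.testBit i) h

theorem incrementer_eq_basisOp (n : ℕ) : incrementer n = basisOp (inc (List.finRange n)) := by
  ext y x
  exact if_congr (by rw [← ofBits_inc_finRange, ofBits_injective.eq_iff]) rfl rfl

theorem exists_implementsWithDirty_incrementer (n : ℕ) : ∃ C : Circuit (Fin n ⊕ Fin 1),
    C.ImplementsWithDirty (incrementer n) ∧ C.depth ≤ 650 * (Nat.clog 2 n + 1) ^ 2 ∧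
      C.gateCount ≤ 164 * n + 650 * (Nat.clog 2 n + 1) ^ 2 := by
  have hinl : (Sum.inl : Fin n → Fin n ⊕ Fin 1).Injective := Sum.inl_injective
  obtain ⟨C, -, hC, hd, hk⟩ := realizes_inc (Nat.clog 2 n) (b := Sum.inr 0)
    (l := (List.finRange n).map (Sum.inl : Fin n → Fin n ⊕ Fin 1))
    (by simpa using Nat.le_pow_clog one_lt_two n)
    (List.nodup_cons.2 ⟨by simp, (List.nodup_finRange n).map hinl⟩)
  refine ⟨C, ?_, hd, by simpa using hk⟩
  rw [incrementer_eq_basisOp]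
  exact C.implementsWithDirty_basisOp (fun x => by rw [hC, inc_map_comp hinl])
    fun x => funext fun j => by rw [hC, comp_apply, inc_of_notMem (by simp), comp_apply]

theorem one_le_logb_two_natCast {n : ℕ} (hn : 2 ≤ n) : 1 ≤ Real.logb 2 n := by
  rw [Real.le_logb_iff_rpow_le one_lt_two (by positivity), Real.rpow_one]
  exact_mod_cast hn

theorem clog_add_one_isBigO_logb :
    (fun n : ℕ => (Nat.clog 2 n : ℝ) + 1) =O[Filter.atTop] fun n : ℕ => Real.logb 2 n := by
  refine Asymptotics.IsBigO.of_bound 3 ?_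
  filter_upwards [Filter.eventually_ge_atTop 2] with n hn
  have hlog := one_le_logb_two_natCast hn
  have hclog : (Nat.clog 2 n : ℝ) < Real.logb 2 n + 1 := by
    have hceil := Real.natCeil_logb_natCast 2 n
    rw [Nat.cast_ofNat] at hceil
    exact hceil ▸ Nat.ceil_lt_add_one (by linarith)
  rw [Real.norm_of_nonneg (by positivity), Real.norm_of_nonneg (by positivity)]
  linarith

theorem logb_sq_isBigO_natCast :
    (fun n : ℕ => Real.logb 2 n ^ 2) =O[Filter.atTop] fun n : ℕ => (n : ℝ) := by
  have h := ((Real.isLittleO_pow_log_id_atTop (n := 2)).comp_tendsto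
    tendsto_natCast_atTop_atTop).isBigO.const_mul_left ((Real.log 2)⁻¹ ^ 2)
  refine h.congr_left fun n => ?_
  rw [comp_apply, Real.logb]
  ring

theorem natCast_isBigO_natCast_mul_logb :
    (fun n : ℕ => (n : ℝ)) =O[Filter.atTop] fun n : ℕ => n * Real.logb 2 n := by
  refine Asymptotics.IsBigO.of_bound' ?_
  filter_upwards [Filter.eventually_ge_atTop 2] with n hn
  have hlog := one_le_logb_two_natCast hn
  rw [Real.norm_of_nonneg (by positivity), Real.norm_of_nonneg (by positivity)]
  exact le_mul_of_one_le_right (by positivity) hlog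

end QCircuit

theorem mainTheorem7_general :
    ∃ C : (n : ℕ) → QCircuit.Circuit (Fin n ⊕ Fin 1),
      (∀ n : ℕ, (C n).ImplementsWithDirty (QCircuit.incrementer n)) ∧
      Asymptotics.IsBigO Filter.atTop
        (fun n : ℕ => ((C n).depth : ℝ)) (fun n : ℕ => Real.logb 2 (n : ℝ) ^ 2) ∧
      Asymptotics.IsBigO Filter.atTop
        (fun n : ℕ => ((C n).gateCount : ℝ)) (fun n : ℕ => (n : ℝ)) := by
  choose C hC hd hk using QCircuit.exists_implementsWithDirty_incrementer
  have hlog := QCircuit.clog_add_one_isBigO_logb.pow 2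
  have hn := Asymptotics.isBigO_refl (fun n : ℕ => (n : ℝ)) Filter.atTop
  have hsq := hlog.trans QCircuit.logb_sq_isBigO_natCast
  refine ⟨C, hC, .trans (.of_norm_le fun n => ?_) (hlog.const_mul_left 650),
    .trans (.of_norm_le fun n => ?_) ((hn.const_mul_left 164).add (hsq.const_mul_left 650))⟩
  · rw [Real.norm_natCast]
    exact_mod_cast hd n
  · rw [Real.norm_natCast]
    exact_mod_cast hk n

/-- There are circuits over {Toffoli, CNOT, X}, one for each `n`, that implement the `n`-bit
incrementer with one dirty ancilla qubit, in depth `O(log² n)` and with `O(n log n)` gates. -/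
theorem mainTheorem7 :
    ∃ C : (n : ℕ) → QCircuit.Circuit (Fin n ⊕ Fin 1),
      (∀ n : ℕ, (C n).ImplementsWithDirty (QCircuit.incrementer n)) ∧
      Asymptotics.IsBigO Filter.atTop
        (fun n : ℕ => ((C n).depth : ℝ)) (fun n : ℕ => Real.logb 2 (n : ℝ) ^ 2) ∧
      Asymptotics.IsBigO Filter.atTop
        (fun n : ℕ => ((C n).gateCount : ℝ)) (fun n : ℕ => (n : ℝ) * Real.logb 2 (n : ℝ)) :=
  let ⟨C, hC, hd, hk⟩ := mainTheorem7_general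
  ⟨C, hC, hd, hk.trans QCircuit.natCast_isBigO_natCast_mul_logb⟩
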